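/- All rings are commutative and Noetherian with $1$. For an ideal $I$ of a ring $R$ and $n\ge 1$, let $\mathrm{Um}_n(R,I)$ be the set of rows $v\in R^n$ that are unimodular ($\sum_i v_iw_i=1$ for some $w\in R^n$) and congruent to $e_1=(1,0,\dots,0)$ modulo $I$. Let $\mathrm{E}_n(R)$ be the group generated by all elementary matrices $e_{ij}(\lambda)$ ($i\ne j$, $\lambda\in R$) of size $n$, and let $\mathrm{E}_n(R,I)$ be the normal closure in $\mathrm{E}_n(R)$ of the subgroup generated by the $e_{ij}(\lambda)$ with $i\neq j$ and $\lambda\in I$. The group $\mathrm{E}_n(R,I)$ acts on $\mathrm{Um}_n(R,I)$ by right multiplication; $\mathrm{Um}_n(R,I)/\mathrm{E}_n(R,I)$ denotes the set of orbits. For $a\in R$ we write $a$ in place of the principal ideal $(a)$. **Lemma 3.3.** Let $R\subset S$ be (commutative Noetherian) rings of Krull dimension at most $d$, where $d\ge 2$, and let $x\in R$ be a nonzero divisor in $S$ such that $R_x=S_x$, i.e. the canonical map $R[1/x]\to S[1/x]$ is an isomorphism. Then the canonical map $$\mathrm{Um}_{d+1}(R,x^n)/\mathrm{E}_{d+1}(R,x^n)\longrightarrow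 \mathrm{Um}_{d+1}(S,x^n)/\mathrm{E}_{d+1}(S,x^n)$$ is surjective for all $n\ge 0$. -/

import Mathlib

namespace UnimodularRows

open Matrix

variable {R S : Type*} [CommRing R] [CommRing S] {n : ℕ}

/-- A row `v ∈ Rⁿ` is unimodular if `∑ vᵢ wᵢ = 1` for some row `w ∈ Rⁿ`. -/
def IsUnimodular (v : Fin n → R) : Prop :=
  ∃ w : Fin n → R, ∑ i, v i * w i = 1

/-- `Um_n(R, I)`: the unimodular rows of length `n ≥ 1` congruent to `e₁ = (1, 0, …, 0)`
modulo `I`. (The coordinates are numbered from `0`.) -/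
def Um (n : ℕ) [NeZero n] (I : Ideal R) : Set (Fin n → R) :=
  {v | IsUnimodular v ∧ ∀ i, v i - (Pi.single 0 1 : Fin n → R) i ∈ I}

/-- `E_n(I)`: the subgroup generated by the elementary matrices `e_{ij}(a)` with `i ≠ j` and
`a ∈ I`. Here `e_{ij}(a) = SpecialLinearGroup.transvection h a` is the identity matrix with `a` put
at the place `(i, j)`. -/
def EIdeal (n : ℕ) (I : Ideal R) : Subgroup (SpecialLinearGroup (Fin n) R) :=
  Subgroup.closure {M | ∃ (i j : Fin n) (h : i ≠ j), ∃ a ∈ I, M = SpecialLinearGroup.transvection h a}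

/-- `E_n(R)`: the subgroup generated by all the elementary matrices. -/
def E (n : ℕ) (R : Type*) [CommRing R] : Subgroup (SpecialLinearGroup (Fin n) R) :=
  EIdeal n (⊤ : Ideal R)

/-- `E_n(R, I)`: the normal closure of `E_n(I)` in `E_n(R)`, regarded as a group of `n × n`
matrices. -/
def ERel (n : ℕ) (I : Ideal R) : Subgroup (SpecialLinearGroup (Fin n) R) :=
  (Subgroup.normalClosure (((EIdeal n I).subgroupOf (E n R) : Subgroup (E n R)) :
    Set (E n R))).map (E n R).subtype

/-- Two rows in `Um_n(R, I)` are equivalent if they lie in the same orbit of `E_n(R, I)`, acting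
by right multiplication. -/
def orbitSetoid (n : ℕ) [NeZero n] (I : Ideal R) : Setoid (Um n I) where
  r v w := ∃ α ∈ ERel n I, (v : Fin n → R) ᵥ* α.1 = w
  iseqv :=
    { refl := fun v => ⟨1, one_mem _, by simp⟩
      symm := by
        rintro v w ⟨α, hα, h⟩
        refine ⟨α⁻¹, inv_mem hα, ?_⟩
        have h1 : α.1 * (α⁻¹).1 = 1 := congrArg (fun γ => γ.1) (mul_inv_cancel α)
        rw [← h, vecMul_vecMul, h1, vecMul_one]
      trans := by
        rintro u v w ⟨α, hα, h⟩ ⟨β, hβ, h'⟩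
        refine ⟨α * β, mul_mem hα hβ, ?_⟩
        have h1 : (α * β).1 = α.1 * β.1 := rfl
        rw [h1, ← vecMul_vecMul, h, h'] }

/-- The orbit set `Um_n(R, I) / E_n(R, I)`. -/
def UmModE (n : ℕ) [NeZero n] (I : Ideal R) : Type _ :=
  Quotient (orbitSetoid n I)

theorem map_transvection (f : R →+* S) {i j : Fin n} (h : i ≠ j) (a : R) :
    SpecialLinearGroup.map f (SpecialLinearGroup.transvection h a) =
      SpecialLinearGroup.transvection h (f a) := by
  ext k l
  change f ((1 + single i j a : Matrix (Fin n) (Fin n) R) k l) =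
    (1 + single i j (f a) : Matrix (Fin n) (Fin n) S) k l
  simp only [Matrix.add_apply, Matrix.one_apply, Matrix.single_apply]
  split_ifs <;> simp

theorem map_mem_EIdeal (f : R →+* S) {I : Ideal R} {J : Ideal S} (hIJ : I ≤ J.comap f)
    {α : SpecialLinearGroup (Fin n) R} (hα : α ∈ EIdeal n I) :
    SpecialLinearGroup.map f α ∈ EIdeal n J := by
  have : EIdeal n I ≤ (EIdeal n J).comap (SpecialLinearGroup.map f) := by
    refine (Subgroup.closure_le _).2 ?_
    rintro _ ⟨i, j, h, a, ha, rfl⟩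
    exact Subgroup.subset_closure ⟨i, j, h, f a, hIJ ha, map_transvection f h a⟩
  exact this hα

theorem map_mem_ERel (f : R →+* S) {I : Ideal R} {J : Ideal S} (hIJ : I ≤ J.comap f)
    {α : SpecialLinearGroup (Fin n) R} (hα : α ∈ ERel n I) :
    SpecialLinearGroup.map f α ∈ ERel n J := by
  obtain ⟨β, hβ, rfl⟩ := hα
  let φ : E n R →* E n S := ((SpecialLinearGroup.map f).comp (E n R).subtype).codRestrict (E n S)
    fun γ => map_mem_EIdeal f le_top γ.2
  have key : Subgroup.normalClosure (((EIdeal n I).subgroupOf (E n R) : Subgroup (E n R)) :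
      Set (E n R)) ≤ (Subgroup.normalClosure
        (((EIdeal n J).subgroupOf (E n S) : Subgroup (E n S)) : Set (E n S))).comap φ := by
    refine Subgroup.normalClosure_le_normal fun γ hγ => ?_
    exact Subgroup.subset_normalClosure (map_mem_EIdeal f hIJ hγ)
  exact ⟨φ β, key hβ, rfl⟩

/-- A ring homomorphism `f : R → S` with `f(I) ⊆ J` maps `Um_n(R, I)` to `Um_n(S, J)`. -/
def Um.map [NeZero n] (f : R →+* S) {I : Ideal R} {J : Ideal S} (hIJ : I ≤ J.comap f)
    (v : Um n I) : Um n J :=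
  ⟨fun i => f (v.1 i), by
    obtain ⟨⟨w, hw⟩, hv⟩ := v.2
    refine ⟨⟨fun i => f (w i), by simp only [← map_mul, ← map_sum, hw, map_one]⟩, fun i => ?_⟩
    have h : f (v.1 i - (Pi.single 0 1 : Fin n → R) i) ∈ J := hIJ (hv i)
    have h2 : f ((Pi.single 0 1 : Fin n → R) i) = (Pi.single 0 1 : Fin n → S) i := by
      simp only [Pi.single_apply]
      split_ifs <;> simp
    rwa [map_sub, h2] at h⟩

/-- The canonical map `Um_n(R, I) / E_n(R, I) → Um_n(S, J) / E_n(S, J)` induced by a ring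
homomorphism `f : R → S` with `f(I) ⊆ J`. -/
def UmModE.map (n : ℕ) [NeZero n] (f : R →+* S) {I : Ideal R} {J : Ideal S}
    (hIJ : I ≤ J.comap f) : UmModE n I → UmModE n J :=
  Quotient.map (sa := orbitSetoid n I) (sb := orbitSetoid n J) (Um.map f hIJ) (by
    rintro v w ⟨α, hα, h⟩
    refine ⟨SpecialLinearGroup.map f α, map_mem_ERel f hIJ hα, ?_⟩
    funext i
    have := congrArg f (congrFun h i)
    simpa [Um.map, vecMul, dotProduct] using this)

theorem span_pow_le_comap (f : R →+* S) (x : R) (m : ℕ) :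
    Ideal.span {x ^ m} ≤ (Ideal.span {f x ^ m}).comap f := by
  rw [Ideal.span_singleton_le_iff_mem, Ideal.mem_comap, map_pow]
  exact Ideal.mem_span_singleton_self _

end UnimodularRows

/-!
The relation `RowEquiv I` (lying in one orbit of `E_n(S, I)`) is studied on all rows over `S`. Since
`S ⊆ R[1/x]`, the task is to clear denominators in a row `v ∈ Um_{d+1}(S, xⁿ)` by relative
elementary operations.

Suppose `n > 0`. Prime avoidance in `R` (`exists_add_mul_le_height`) allows the first `d` entries
`f₀, …, f_{d-1}` to be chosen such that the primes of `R` that contain their numerators but not `x`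
have height at least `d`. As `dim R ≤ d`, these primes are maximal, so the ideal of the numerators
contains `xᵐ τ` with `τ ∈ R` congruent to `1` modulo `x` (`exists_add_eq_one_of_le_height`). Two
steps remain (`exists_um_rowEquiv`).

* The entries `fᵢ` are multiplied by powers of `x`, which brings them into `R`. If `t` is a unit
  modulo one entry, a factor `t` may be moved from a second entry to a third one, by Whitehead's
  lemma (`rowEquiv_move_factor`). At first `x` is a unit modulo `f₀`, so the last entry can be made
  divisible by a high power of `x`, which is spread over `f₁, …, f_{d-1}`. What is left of the last
  entry is then changed modulo `f₀` into some `q` congruent to `1` modulo a high power of `x`; now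
  `x` is a unit modulo `q`, and a surplus power of `x` is moved from `f₁` to `f₀`. For this the role
  of the entry that is congruent to `1` passes from `f₀` to `q`, by conjugation with a product of
  elementary matrices defined over `R`.
* The entry `q` is replaced by an element of `R`. As `x` is a unit modulo `τ`, there is `ρ ∈ R`
  such that `q - ρ` is a multiple of a high power of `x` times `τ`
  (`exists_sub_eq_mul_of_add_eq_one`), hence a combination of the other entries with coefficients
  in `xⁿ S`.

For `n = 0` the relation `dim S / x < d` and prime avoidance modulo `x` move any unimodular row into
`Um_{d+1}(S, x)` (`exists_rowEquiv_mem_um`), and the case `n = 1` applies.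
-/

namespace UnimodularRows

open Matrix

/-! ### Relative elementary operations on rows -/

section RowEquiv


variable {R : Type*} [CommRing R] {n : ℕ} {I J : Ideal R} {u v w : Fin n → R}

/-- Two rows of length `n` are equivalent relative to `I` if they lie in the same orbit of
`E_n(R, I)`. The rows are not required to be unimodular. -/
def RowEquiv (I : Ideal R) (v w : Fin n → R) : Prop :=
  ∃ α ∈ ERel n I, v ᵥ* α.1 = w

theorem RowEquiv.refl (v : Fin n → R) : RowEquiv I v v :=
  ⟨1, one_mem _, by simp⟩

theorem vecMul_coe_mul (v : Fin n → R) (α β : SpecialLinearGroup (Fin n) R) :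
    v ᵥ* (α * β).1 = v ᵥ* α.1 ᵥ* β.1 :=
  (vecMul_vecMul v α.1 β.1).symm

theorem vecMul_coe_mul_inv (v : Fin n → R) (α : SpecialLinearGroup (Fin n) R) :
    v ᵥ* α.1 ᵥ* (α⁻¹).1 = v := by
  rw [← vecMul_coe_mul, mul_inv_cancel]
  exact vecMul_one v

theorem RowEquiv.trans (h : RowEquiv I u v) (h' : RowEquiv I v w) : RowEquiv I u w := by
  obtain ⟨α, hα, rfl⟩ := h
  obtain ⟨β, hβ, rfl⟩ := h'
  exact ⟨α * β, mul_mem hα hβ, vecMul_coe_mul u α β⟩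

theorem RowEquiv.symm (h : RowEquiv I v w) : RowEquiv I w v := by
  obtain ⟨α, hα, rfl⟩ := h
  exact ⟨α⁻¹, inv_mem hα, vecMul_coe_mul_inv v α⟩

theorem RowEquiv.mono (hIJ : I ≤ J) (h : RowEquiv I v w) : RowEquiv J v w := by
  obtain ⟨α, hα, rfl⟩ := h
  refine ⟨α, ?_, rfl⟩
  have := map_mem_ERel (n := n) (RingHom.id R) (I := I) (J := J) (by simpa using hIJ) hα
  convert this
  ext
  simp

/-- `E_n(R)` permutes the orbits of its normal subgroup `E_n(R, I)`. -/
theorem RowEquiv.vecMul (h : RowEquiv I v w) {γ : SpecialLinearGroup (Fin n) R}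
    (hγ : γ ∈ E n R) : RowEquiv I (v ᵥ* γ.1) (w ᵥ* γ.1) := by
  obtain ⟨_, ⟨β, hβ, rfl⟩, rfl⟩ := h
  let g : E n R := ⟨γ, hγ⟩
  refine ⟨γ⁻¹ * β.1 * γ, ⟨g⁻¹ * β * g, ?_, rfl⟩, ?_⟩
  · have := Subgroup.normalClosure_normal.conj_mem β hβ g⁻¹
    rwa [inv_inv] at this
  · rw [vecMul_coe_mul, vecMul_coe_mul, vecMul_coe_mul_inv]
    rfl

theorem RowEquiv.isUnimodular (h : RowEquiv I v w) (hv : IsUnimodular v) : IsUnimodular w := by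
  obtain ⟨α, -, rfl⟩ := h
  obtain ⟨z, hz⟩ := hv
  refine ⟨(α⁻¹).1 *ᵥ z, ?_⟩
  change (v ᵥ* α.1) ⬝ᵥ ((α⁻¹).1 *ᵥ z) = 1
  rw [dotProduct_mulVec, vecMul_coe_mul_inv]
  exact hz

theorem vecMul_transvection {i j : Fin n} (h : i ≠ j) (a : R) (v : Fin n → R) :
    v ᵥ* (SpecialLinearGroup.transvection h a).1 = Function.update v j (v j + a * v i) := by
  change v ᵥ* (1 + Matrix.single i j a) = _
  rw [vecMul_add, vecMul_one]
  ext k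
  by_cases hk : k = j
  · subst hk
    simp [Matrix.vecMul, dotProduct, Matrix.single_apply, mul_comm]
  · simp [hk, Matrix.vecMul, dotProduct, Ne.symm hk]

theorem transvection_mem_E {i j : Fin n} (h : i ≠ j) (a : R) :
    SpecialLinearGroup.transvection h a ∈ E n R :=
  Subgroup.subset_closure ⟨i, j, h, a, Submodule.mem_top, rfl⟩

theorem rowEquiv_update {i j : Fin n} (h : i ≠ j) {a : R} (ha : a ∈ I) (v : Fin n → R) :
    RowEquiv I v (Function.update v j (v j + a * v i)) := by
  refine ⟨SpecialLinearGroup.transvection h a, ?_, vecMul_transvection h a v⟩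
  exact ⟨⟨_, transvection_mem_E h a⟩,
    Subgroup.subset_normalClosure (Subgroup.subset_closure ⟨i, j, h, a, ha, rfl⟩), rfl⟩

theorem rowEquiv_update_sum (j : Fin n) (s : Finset (Fin n)) (hj : j ∉ s) (a : Fin n → R)
    (ha : ∀ i ∈ s, a i ∈ I) (v : Fin n → R) :
    RowEquiv I v (Function.update v j (v j + ∑ i ∈ s, a i * v i)) := by
  induction s using Finset.induction_on with
  | empty => simpa using RowEquiv.refl v
  | insert i s hi ih =>
    rw [Finset.mem_insert, not_or] at hj
    refine (ih hj.2 fun k hk => ha k (Finset.mem_insert_of_mem hk)).trans ?_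
    convert rowEquiv_update (Ne.symm hj.1) (ha i (Finset.mem_insert_self i s)) _ using 1
    rw [Finset.sum_insert hi, Function.update_self, Function.update_idem,
      Function.update_of_ne (Ne.symm hj.1)]
    congr 1
    ring

theorem rowEquiv_add_smul (j : Fin n) (a : Fin n → R) (ha : ∀ i, a i ∈ I) (haj : a j = 0)
    (v : Fin n → R) : RowEquiv I v (fun i => v i + a i * v j) := by
  suffices H : ∀ s : Finset (Fin n), j ∉ s →
      RowEquiv I v (fun i => if i ∈ s then v i + a i * v j else v i) by
    convert H (Finset.univ.erase j) (by simp) using 2 with i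
    by_cases hi : i = j
    · simp [hi, haj]
    · simp [hi]
  intro s
  induction s using Finset.induction_on with
  | empty => exact fun _ => by simpa using RowEquiv.refl v
  | insert i s hi ih =>
    intro hj
    rw [Finset.mem_insert, not_or] at hj
    refine (ih hj.2).trans ?_
    convert rowEquiv_update hj.1 (ha i) _ using 1
    ext k
    by_cases hk : k = i
    · subst hk
      simp [hi, hj.2]
    · simp [hk]

/-- An elementary operation with an arbitrary coefficient `a` is allowed relative to `I` when it
adds a multiple of an entry in `I`, and a third entry is congruent to `1` modulo `I`. -/
theorem rowEquiv_update_of_mem {p i j : Fin n} (hpj : p ≠ j) (hij : i ≠ j)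
    {v : Fin n → R} (hp : v p - 1 ∈ I) (hi : v i ∈ I) (a : R) :
    RowEquiv I v (Function.update v j (v j + a * v i)) := by
  -- `a vᵢ = (a vᵢ) v_p + (a (1 - v_p)) vᵢ`, where both coefficients lie in `I`
  have h1 := rowEquiv_update hpj (I.mul_mem_left a hi) v
  have h2 := rowEquiv_update hij (I.mul_mem_left (-a) hp)
    (Function.update v j (v j + a * v i * v p))
  convert h1.trans h2 using 1
  rw [Function.update_self, Function.update_idem, Function.update_of_ne hij]
  congr 1
  ring

/-- If `t` is a unit modulo `v_p`, then a factor `t` can be moved from the entry `vⱼ` to the entry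
`vᵢ`: this is Whitehead's lemma for `diag(t, t⁻¹)` modulo `v_p`. -/
theorem rowEquiv_move_factor {p i j : Fin n} (hpi : p ≠ i) (hpj : p ≠ j) (hij : i ≠ j)
    {v : Fin n → R} (hp : v p - 1 ∈ I) (hi : v i ∈ I) {t c y z : R} (hc : c ∈ I)
    (hj : v j = t * c) (hyz : t * y + v p * z = 1) :
    RowEquiv I v (Function.update (Function.update v i (t * v i)) j c) := by
  -- `(b, t c) ↦ (b + c, t c) ↦ (b + c, c + (1 - t) b) ↦ (t b, c + (1 - t) b) ↦ (t b, c)`, where the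
  -- first and the last step involve the inverse `y` of `t` and are corrected by multiples of `v_p`
  let row (b c : R) : Fin n → R := Function.update (Function.update v i b) j c
  have rp (b c) : row b c p = v p := by simp [row, hpi, hpj]
  have ri (b c) : row b c i = b := by simp [row, hij]
  have rj (b c) : row b c j = c := by simp [row]
  have ui (b c b') : Function.update (row b c) i b' = row b' c := by
    simp only [row]
    rw [Function.update_comm hij.symm, Function.update_idem]
  have uj (b c c') : Function.update (row b c) j c' = row b c' := by simp [row]
  have addi (b c a : R) (hc : c ∈ I) : RowEquiv I (row b c) (row (b + a * c) c) := by
    have := rowEquiv_update_of_mem (v := row b c) hpi hij.symm (by rwa [rp]) (by rwa [rj]) a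
    rwa [ui, ri, rj] at this
  have addj (b c a : R) (hb : b ∈ I) : RowEquiv I (row b c) (row b (c + a * b)) := by
    have := rowEquiv_update_of_mem (v := row b c) hpj hij (by rwa [rp]) (by rwa [ri]) a
    rwa [uj, ri, rj] at this
  have addpi (b c a : R) (ha : a ∈ I) : RowEquiv I (row b c) (row (b + a * v p) c) := by
    have := rowEquiv_update (v := row b c) hpi ha
    rwa [ui, ri, rp] at this
  have addpj (b c a : R) (ha : a ∈ I) : RowEquiv I (row b c) (row b (c + a * v p)) := by
    have := rowEquiv_update (v := row b c) hpj ha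
    rwa [uj, rj, rp] at this
  have h0 : v = row (v i) (t * c) := by simp [row, ← hj]
  set b := v i
  have hy : y * t = 1 - v p * z := by rw [← hyz]; ring
  have htc : t * c ∈ I := I.mul_mem_left t hc
  have hbc : b + c ∈ I := I.add_mem hi hc
  have e1 : b + y * (t * c) + (z * c) * v p = b + c := by
    linear_combination c * hy
  have e2 : b + c + -1 * (t * c + (1 - t) * (b + c)) = t * b := by ring
  have e3 : t * c + (1 - t) * (b + c) + (-(1 - t) * y) * (t * b) + (-(1 - t) * z * b) * v p
      = c := by
    linear_combination (-(1 - t) * b) * hy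
  have s1 := addi b (t * c) y htc
  have s2 := addpi (b + y * (t * c)) (t * c) (z * c) (I.mul_mem_left z hc)
  rw [e1] at s2
  have s3 := addj (b + c) (t * c) (1 - t) hbc
  have s4 := addi (b + c) (t * c + (1 - t) * (b + c)) (-1) (I.add_mem htc (I.mul_mem_left _ hbc))
  rw [e2] at s4
  have s5 := addj (t * b) (t * c + (1 - t) * (b + c)) (-(1 - t) * y) (I.mul_mem_left t hi)
  have s6 := addpj (t * b) (t * c + (1 - t) * (b + c) + (-(1 - t) * y) * (t * b))
    (-(1 - t) * z * b) (I.mul_mem_left _ hi)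
  rw [e3] at s6
  rw [h0]
  convert ((((s1.trans s2).trans s3).trans s4).trans s5).trans s6 using 1
  ext k
  by_cases hkj : k = j
  · simp [row, hkj]
  · by_cases hki : k = i <;> simp [row, hkj, hki, hij, b]

/-- If `t` is a unit modulo `v_p`, then a factor `t ^ |s|` of the entry `vⱼ` can be spread over the
entries with index in `s`. -/
theorem rowEquiv_move_factors {p j : Fin n} (hpj : p ≠ j) (s : Finset (Fin n)) (hps : p ∉ s)
    (hjs : j ∉ s) {t y z : R} :
    ∀ {v : Fin n → R} {c : R}, v p - 1 ∈ I → (∀ i ∈ s, v i ∈ I) → c ∈ I →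
      v j = t ^ s.card * c → t * y + v p * z = 1 →
      RowEquiv I v (fun i => if i = j then c else if i ∈ s then t * v i else v i) := by
  induction s using Finset.induction_on with
  | empty =>
    intro v c _ _ _ hj _
    convert RowEquiv.refl v using 2 with i
    by_cases hi : i = j
    · simp [hi, hj]
    · simp [hi]
  | insert a s ha ih =>
    intro v c hp hs hc hj hyz
    rw [Finset.mem_insert, not_or] at hps hjs
    rw [Finset.card_insert_of_notMem ha, pow_succ, mul_assoc] at hj
    refine (ih hps.2 hjs.2 hp (fun i hi => hs i (Finset.mem_insert_of_mem hi))
      (I.mul_mem_left t hc) hj hyz).trans ?_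
    have haj : a ≠ j := Ne.symm hjs.1
    convert rowEquiv_move_factor (I := I) (t := t) (c := c) (y := y) (z := z) (p := p) (i := a)
      (j := j) hps.1 hpj haj ?_ ?_ hc ?_ ?_ using 1
    · ext k
      by_cases hkj : k = j
      · simp [hkj]
      · by_cases hka : k = a
        · simp [hka, haj, ha]
        · simp [hkj, hka]
    · simpa [hpj, hps.2] using hp
    · simpa [haj, ha] using hs a (Finset.mem_insert_self a s)
    · simp
    · simpa [hpj, hps.2] using hyz

end RowEquiv

/-! ### Prime avoidance and heights -/

section PrimeAvoidance


variable {A : Type*} [CommRing A]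

/-- Coset prime avoidance for the minimal primes over an ideal: as they are pairwise incomparable,
some element lies in exactly those that do not contain `g`. -/
theorem exists_add_mul_notMem_minimalPrimes [IsNoetherianRing A] (J : Ideal A) (g w : A) :
    ∃ a : A, ∀ Q ∈ J.minimalPrimes, w ∉ Q → g + a * w ∉ Q := by
  classical
  have hfin : J.minimalPrimes.Finite := J.finite_minimalPrimes_of_isNoetherianRing
  let s := hfin.toFinset
  have hs {Q : Ideal A} : Q ∈ s ↔ Q ∈ J.minimalPrimes := by simp [s]
  let B := (s.filter fun Q => g ∉ Q).inf id
  have key : ∃ a ∈ B, ∀ Q ∈ s, g ∈ Q → a ∉ Q := by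
    by_contra! h
    have hsub : (B : Set A) ⊆ ⋃ Q ∈ ((s.filter fun Q => g ∈ Q : Finset (Ideal A)) : Set (Ideal A)),
        ((id Q : Ideal A) : Set A) := by
      intro a ha
      obtain ⟨Q, hQ, hg, haQ⟩ := h a ha
      simp only [Set.mem_iUnion]
      exact ⟨Q, by simp [hQ, hg], haQ⟩
    replace hsub := (Ideal.subset_union_prime (f := id) ⊥ ⊥ (fun Q hQ _ _ =>
      (hs.1 (Finset.mem_filter.1 hQ).1).1.1)).1 hsub
    obtain ⟨Q, hQ, hBQ⟩ := hsub
    obtain ⟨hQ, hgQ⟩ := Finset.mem_filter.1 hQ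
    have hQp := (hs.1 hQ).1.1
    obtain ⟨Q', hQ', hle⟩ := hQp.inf_le'.1 hBQ
    obtain ⟨hQ', hgQ'⟩ := Finset.mem_filter.1 hQ'
    have := (hs.1 hQ).2 (hs.1 hQ').1 hle
    exact hgQ' (this hgQ)
  obtain ⟨a, haB, ha⟩ := key
  refine ⟨a, fun Q hQ hw h => ?_⟩
  have hQp := hQ.1.1
  by_cases hg : g ∈ Q
  · rcases hQp.mem_or_mem ((Ideal.add_mem_iff_right Q hg).1 h) with h | h
    · exact ha Q (hs.2 hQ) hg h
    · exact hw h
  · have haQ : a ∈ Q := (Finset.inf_le (f := id) (Finset.mem_filter.2 ⟨hs.2 hQ, hg⟩) : B ≤ Q) haB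
    exact hg ((Ideal.add_mem_iff_left Q (Q.mul_mem_right w haQ)).1 h)

/-- After adding suitable multiples of `w` to `g₁, …, g_k`, the ideal they generate has height at
least `k` away from `V(w)`. -/
theorem exists_add_mul_le_height [IsNoetherianRing A] (w : A) : ∀ {k : ℕ} (g : Fin k → A),
    ∃ a : Fin k → A, ∀ P : Ideal A, P.IsPrime → (∀ i, g i + a i * w ∈ P) → w ∉ P →
      (k : ℕ∞) ≤ P.height
  | 0, _ => ⟨0, fun _ _ _ _ => by simp⟩
  | k + 1, g => by
    obtain ⟨a, ha⟩ := exists_add_mul_le_height w fun i : Fin k => g i.castSucc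
    obtain ⟨b, hb⟩ := exists_add_mul_notMem_minimalPrimes
      (Ideal.span (Set.range fun i : Fin k => g i.castSucc + a i * w)) (g (Fin.last k)) w
    refine ⟨Fin.snoc (α := fun _ => A) a b, fun P hP hmem hw => ?_⟩
    have hle : Ideal.span (Set.range fun i : Fin k => g i.castSucc + a i * w) ≤ P := by
      rw [Ideal.span_le]
      rintro _ ⟨i, rfl⟩
      simpa using hmem i.castSucc
    obtain ⟨Q, hQ, hQP⟩ := Ideal.exists_minimalPrimes_le hle
    have hQp := hQ.1.1
    have hwQ : w ∉ Q := fun h => hw (hQP h)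
    have hlt : Q < P := lt_of_le_of_ne hQP fun h =>
      hb Q hQ hwQ (h ▸ by simpa using hmem (Fin.last k))
    have h1 := ha Q hQp (fun i => hQ.1.2 (Ideal.subset_span ⟨i, rfl⟩)) hwQ
    have h2 := Ideal.height_add_one_le_of_lt_of_isPrime hlt
    push_cast
    exact (add_le_add_left h1 1).trans h2

/-- Let `dim A ≤ d`. If the primes over `J` that avoid `x` have height at least `d`, they are
maximal, so `x` becomes a unit modulo the `x`-saturation of `J`. -/
theorem exists_add_eq_one_of_le_height {d : ℕ} (hdim : ringKrullDim A ≤ d) (x : A) (J : Ideal A)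
    (hJ : ∀ P : Ideal A, P.IsPrime → J ≤ P → x ∉ P → (d : ℕ∞) ≤ P.height) :
    ∃ (τ μ : A) (m : ℕ), τ + x * μ = 1 ∧ x ^ m * τ ∈ J := by
  by_contra! hcon
  -- the `x`-saturation of `J`
  let T : Ideal A :=
    { carrier := {a | ∃ m : ℕ, x ^ m * a ∈ J}
      add_mem' := by
        rintro a b ⟨m, hm⟩ ⟨m', hm'⟩
        refine ⟨m + m', ?_⟩
        have := J.add_mem (J.mul_mem_left (x ^ m') hm) (J.mul_mem_left (x ^ m) hm')
        convert this using 1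
        ring
      zero_mem' := ⟨0, by simp⟩
      smul_mem' := by
        rintro c a ⟨m, hm⟩
        refine ⟨m, ?_⟩
        have := J.mul_mem_left c hm
        convert this using 1
        simp only [smul_eq_mul]
        ring }
  have hne : T ⊔ Ideal.span {x} ≠ ⊤ := by
    intro h
    have h1 := (Ideal.eq_top_iff_one _).1 h
    obtain ⟨τ, ⟨m, hm⟩, b, hb, h1⟩ := Submodule.mem_sup.1 h1
    obtain ⟨μ, rfl⟩ := Ideal.mem_span_singleton'.1 hb
    exact hcon τ μ m (by rw [← h1, mul_comm]) hm
  obtain ⟨M, hM, hTM⟩ := Ideal.exists_le_maximal _ hne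
  have hMp := hM.isPrime
  have hxM : x ∈ M := hTM (Ideal.mem_sup_right (Ideal.mem_span_singleton_self x))
  -- a prime `P ⊇ J` inside `M` that does not contain `x`
  have hdisj : Disjoint (J : Set A)
      ((Submonoid.powers x ⊔ M.primeCompl : Submonoid A) : Set A) := by
    rw [Set.disjoint_left]
    intro a haJ ha
    obtain ⟨_, ⟨m, rfl⟩, b, hb, rfl⟩ := Submonoid.mem_sup.1 ha
    exact hb (hTM (Ideal.mem_sup_left ⟨m, haJ⟩))
  obtain ⟨P, hP, hJP, hPd⟩ := Ideal.exists_le_prime_disjoint J _ hdisj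
  rw [Set.disjoint_right] at hPd
  have hxP : x ∉ P := hPd (Submonoid.mem_sup_left (Submonoid.mem_powers x))
  have hPM : P ≤ M := fun a ha => by
    by_contra h
    exact hPd (Submonoid.mem_sup_right (show a ∈ M.primeCompl from h)) ha
  have hlt : P < M := lt_of_le_of_ne hPM fun h => hxP (h ▸ hxM)
  have h1 := hJ P hP hJP hxP
  have h2 := Ideal.height_add_one_le_of_lt_of_isPrime hlt
  have h3 := (Ideal.height_le_ringKrullDim_of_ne_top hMp.ne_top).trans hdim
  have h4 : ((d : ℕ∞) + 1 : ℕ∞) ≤ (d : ℕ∞) := by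
    refine (add_le_add_left h1 1).trans (h2.trans ?_)
    exact_mod_cast h3
  have h5 : d + 1 ≤ d := by exact_mod_cast h4
  omega

end PrimeAvoidance

/-! ### Rows congruent to the first unit vector modulo a nonzerodivisor -/

section DimensionAtMost


variable {R S : Type*} [CommRing R] [CommRing S]

/-- Over a ring of dimension at most `d`, every unimodular row of length `d + 1` can be moved by
`E_{d+1}(S)` into `Um_{d+1}(S, x)`, for any nonzerodivisor `x`: since `dim S / x < d`, prime
avoidance makes the first `d` entries unimodular modulo `x`. -/
theorem exists_rowEquiv_mem_um [IsNoetherianRing S] {d : ℕ} (hd : 1 ≤ d)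
    (hdim : ringKrullDim S ≤ d) {x : S} (hx : x ∈ nonZeroDivisors S) (v : Fin (d + 1) → S)
    (hv : IsUnimodular v) :
    ∃ w ∈ Um (d + 1) (Ideal.span {x}), RowEquiv ⊤ v w := by
  set I := Ideal.span {x} with hI
  have h0l : (0 : Fin (d + 1)) ≠ Fin.last d := by
    rw [Ne, Fin.ext_iff]; simp; omega
  have hdimq : ringKrullDim (S ⧸ I) + 1 ≤ d :=
    (ringKrullDim_quotient_succ_le_of_nonZeroDivisor hx).trans hdim
  obtain ⟨a, ha⟩ := exists_add_mul_le_height (Ideal.Quotient.mk I (v (Fin.last d)))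
    (fun i : Fin d => Ideal.Quotient.mk I (v i.castSucc))
  choose b hb using fun i => Ideal.Quotient.mk_surjective (a i)
  let b' : Fin (d + 1) → S := Fin.snoc (α := fun _ => S) b 0
  let f : Fin (d + 1) → S := fun i => v i + b' i * v (Fin.last d)
  have hvf : RowEquiv ⊤ v f :=
    rowEquiv_add_smul (Fin.last d) b' (fun _ => Submodule.mem_top) (by simp [b']) v
  have hf := hvf.isUnimodular hv
  have hfl : f (Fin.last d) = v (Fin.last d) := by simp [f, b']
  have htop : Ideal.span (Set.range fun i : Fin d => f i.castSucc) ⊔ I = ⊤ := by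
    by_contra hne
    obtain ⟨M, hM, hle⟩ := Ideal.exists_le_maximal _ hne
    have hMp := hM.isPrime
    have hIM : I ≤ M := le_sup_right.trans hle
    have hfM (i : Fin d) : f i.castSucc ∈ M :=
      hle (Ideal.mem_sup_left (Ideal.subset_span ⟨i, rfl⟩))
    have hker : RingHom.ker (Ideal.Quotient.mk I) ≤ M := by rwa [Ideal.mk_ker]
    have hcomap : (M.map (Ideal.Quotient.mk I)).comap (Ideal.Quotient.mk I) = M := by
      rw [Ideal.comap_map_of_surjective _ Ideal.Quotient.mk_surjective]
      exact sup_eq_left.2 hker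
    have hP : (M.map (Ideal.Quotient.mk I)).IsPrime :=
      Ideal.map_isPrime_of_surjective Ideal.Quotient.mk_surjective hker
    have h1 := ha _ hP (fun i => by
      rw [← hb i, ← map_mul, ← map_add]
      have := Ideal.mem_map_of_mem (Ideal.Quotient.mk I) (hfM i)
      simpa [f, b'] using this) (fun h => by
        have hl : v (Fin.last d) ∈ M := by rwa [← hcomap, Ideal.mem_comap]
        obtain ⟨z, hz⟩ := hf
        apply hMp.one_notMem
        rw [← hz]
        refine M.sum_mem fun i _ => M.mul_mem_right _ ?_
        induction i using Fin.lastCases with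
        | last => rwa [hfl]
        | cast i => exact hfM i)
    have h2 := Ideal.height_le_ringKrullDim_of_ne_top hP.ne_top
    have h3 : ((d : ℕ∞) : WithBot ℕ∞) + 1 ≤ d := by
      refine le_trans ?_ hdimq
      exact add_le_add_left ((WithBot.coe_le_coe.2 h1).trans h2) 1
    have h4 : d + 1 ≤ d := by exact_mod_cast h3
    omega
  obtain ⟨e, he, i, hi, hei⟩ := Submodule.mem_sup.1 ((Ideal.eq_top_iff_one _).1 htop)
  obtain ⟨c, hc⟩ := (Ideal.mem_span_range_iff_exists_fun).1 he
  -- the last entry becomes `1 - v₀` modulo `x`, and then `v₀` becomes `1`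
  let c' : Fin (d + 1) → S := Fin.snoc (α := fun _ => S)
    (fun i => (1 - f 0 - f (Fin.last d)) * c i) 0
  have s1 : RowEquiv ⊤ f (Function.update f (Fin.last d) (f (Fin.last d) +
      (1 - f 0 - f (Fin.last d)) * e)) := by
    convert rowEquiv_update_sum (I := ⊤) (Fin.last d) (Finset.univ.erase (Fin.last d)) (by simp) c'
      (fun _ _ => Submodule.mem_top) f using 3
    have : ∑ i ∈ Finset.univ.erase (Fin.last d), c' i * f i = ∑ i, c' i * f i := by
      rw [← Finset.sum_erase_add _ _ (Finset.mem_univ (Fin.last d))]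
      simp [c']
    rw [this, Fin.sum_univ_castSucc, ← hc]
    simp [c', Finset.mul_sum, mul_assoc]
  set g := Function.update f (Fin.last d) (f (Fin.last d) + (1 - f 0 - f (Fin.last d)) * e)
  have s2 := rowEquiv_update (I := ⊤) h0l.symm (a := 1) Submodule.mem_top g
  set h := Function.update g 0 (g 0 + 1 * g (Fin.last d))
  have hh0 : h 0 - 1 ∈ I := by
    have : h 0 - 1 = - (1 - f 0 - f (Fin.last d)) * i := by
      simp only [h, g, Function.update_self, Function.update_of_ne h0l]
      linear_combination (1 - f 0 - f (Fin.last d)) * hei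
    rw [this]
    exact I.mul_mem_left _ hi
  let k : Fin (d + 1) → S := Function.update (fun i => - h i) 0 0
  have s3 := rowEquiv_add_smul (I := ⊤) 0 k (fun _ => Submodule.mem_top) (by simp [k]) h
  refine ⟨_, ⟨?_, ?_⟩, ((hvf.trans s1).trans s2).trans s3⟩
  · exact (((hvf.trans s1).trans s2).trans s3).isUnimodular hv
  · intro i
    by_cases hi0 : i = 0
    · subst hi0
      simpa [k] using hh0
    · have : h i + k i * h 0 - (Pi.single 0 1 : Fin (d + 1) → S) i = - h i * (h 0 - 1) := by
        simp [k, hi0]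
        ring
      rw [this]
      exact I.mul_mem_left _ hh0

end DimensionAtMost

/-! ### Subrings with the same localization -/

section Away


variable {R S : Type*} [CommRing R] [CommRing S] [Algebra R S]

theorem exists_map_eq_pow_mul {x : R} (hx : algebraMap R S x ∈ nonZeroDivisors S)
    (hloc : Function.Surjective (Localization.awayMap (algebraMap R S) x)) (s : S) :
    ∃ (k : ℕ) (r : R), algebraMap R S r = algebraMap R S x ^ k * s := by
  obtain ⟨z, hz⟩ := hloc (algebraMap S (Localization.Away (algebraMap R S x)) s)
  obtain ⟨⟨r, _, k, rfl⟩, rfl⟩ := IsLocalization.mk'_surjective (Submonoid.powers x) z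
  refine ⟨k, r, ?_⟩
  rw [Localization.awayMap, IsLocalization.Away.map, IsLocalization.map_mk',
    IsLocalization.mk'_eq_iff_eq_mul, ← map_mul] at hz
  have hinj : Function.Injective (algebraMap S (Localization.Away (algebraMap R S x))) :=
    IsLocalization.injective _ (Submonoid.powers_le.2 hx)
  have := hinj hz
  rw [this]
  simp [mul_comm]

/-- A common denominator for finitely many elements of `S ⊆ R[1/x]`. -/
theorem exists_forall_map_eq_pow_mul {ι : Type*} [Finite ι] {x : R}
    (h : ∀ s : S, ∃ (k : ℕ) (r : R), algebraMap R S r = algebraMap R S x ^ k * s) (v : ι → S) :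
    ∃ (k : ℕ) (g : ι → R), ∀ i, algebraMap R S (g i) = algebraMap R S x ^ k * v i := by
  cases nonempty_fintype ι
  choose k r hr using fun i => h (v i)
  refine ⟨∑ i, k i, fun i => x ^ (∑ i, k i - k i) * r i, fun i => ?_⟩
  rw [map_mul, map_pow, hr, ← mul_assoc, ← pow_add,
    Nat.sub_add_cancel (Finset.single_le_sum (fun _ _ => Nat.zero_le _) (Finset.mem_univ i))]

/-- A row over `R` that is unimodular over `S ⊆ R[1/x]` and congruent to `e₁` modulo `xⁿ` with
`n > 0` is already unimodular over `R`. -/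
theorem isUnimodular_of_map {x : R} {d n : ℕ} (hn : 0 < n)
    (hRS : Function.Injective (algebraMap R S))
    (h : ∀ s : S, ∃ (k : ℕ) (r : R), algebraMap R S r = algebraMap R S x ^ k * s)
    (u : Fin (d + 1) → R) (hu : u 0 - 1 ∈ Ideal.span {x ^ n})
    (hS : IsUnimodular fun i => algebraMap R S (u i)) : IsUnimodular u := by
  obtain ⟨w, hw⟩ := hS
  obtain ⟨k, g, hg⟩ := exists_forall_map_eq_pow_mul h w
  have hxk : ∑ i, u i * g i = x ^ k := by
    apply hRS
    simp only [map_sum, map_mul, hg, map_pow]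
    refine Eq.trans ?_ (by rw [hw, mul_one] :
      algebraMap R S x ^ k * ∑ i, algebraMap R S (u i) * w i = algebraMap R S x ^ k)
    rw [Finset.mul_sum]
    exact Finset.sum_congr rfl fun i _ => by ring
  obtain ⟨c, hc⟩ := Ideal.mem_span_singleton'.1 hu
  have hcop : IsCoprime (x ^ k) (u 0) := by
    apply IsCoprime.pow_left
    obtain ⟨m, rfl⟩ := Nat.exists_eq_succ_of_ne_zero hn.ne'
    exact ⟨-(c * x ^ m), 1, by rw [pow_succ] at hc; linear_combination -hc⟩
  obtain ⟨a, b, hab⟩ := hcop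
  refine ⟨fun i => a * g i + (Pi.single 0 b : Fin (d + 1) → R) i, ?_⟩
  simp only [mul_add, Finset.sum_add_distrib, Pi.single_apply, mul_ite, mul_zero,
    Finset.sum_ite_eq', Finset.mem_univ, if_true]
  rw [← hab, ← hxk, Finset.mul_sum, mul_comm b]
  congr 1
  exact Finset.sum_congr rfl fun i _ => by ring

/-- After elementary operations relative to `xⁿ`, the first `d` entries of a row in
`Um_{d+1}(S, xⁿ)` have numerators in `R` that generate an ideal whose `x`-saturation contains an
element `τ` congruent to `1` modulo `x`. -/
theorem exists_rowEquiv_saturation [IsNoetherianRing R] {d n : ℕ} (hd : 1 ≤ d)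
    (hdim : ringKrullDim R ≤ d) (x : R)
    (hRS : Function.Injective (algebraMap R S))
    (h : ∀ s : S, ∃ (k : ℕ) (r : R), algebraMap R S r = algebraMap R S x ^ k * s)
    (v : Fin (d + 1) → S) (hv : v ∈ Um (d + 1) (Ideal.span {algebraMap R S x ^ n})) :
    ∃ f ∈ Um (d + 1) (Ideal.span {algebraMap R S x ^ n}),
      RowEquiv (Ideal.span {algebraMap R S x ^ n}) v f ∧
      ∃ (K : ℕ) (g : Fin d → R),
        (∀ i, algebraMap R S (g i) = algebraMap R S x ^ K * f i.castSucc) ∧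
        ∃ (τ μ : R) (m : ℕ), τ + x * μ = 1 ∧ x ^ m * τ ∈ Ideal.span (Set.range g) := by
  set X := algebraMap R S x with hX
  obtain ⟨hvu, hv1⟩ := hv
  obtain ⟨K, g, hg⟩ := exists_forall_map_eq_pow_mul h v
  obtain ⟨a, ha⟩ := exists_add_mul_le_height (x ^ n * g (Fin.last d)) fun i : Fin d => g i.castSucc
  let b : Fin (d + 1) → S :=
    Fin.snoc (α := fun _ => S) (fun i => algebraMap R S (a i) * X ^ n) 0
  have hb : ∀ i, b i ∈ Ideal.span {X ^ n} := by
    intro i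
    induction i using Fin.lastCases with
    | last => simp [b]
    | cast i =>
      simp only [b, Fin.snoc_castSucc]
      exact Ideal.mul_mem_left _ _ (Ideal.mem_span_singleton_self _)
  have hvf := rowEquiv_add_smul (I := Ideal.span {X ^ n}) (Fin.last d) b hb (by simp [b]) v
  set f : Fin (d + 1) → S := fun i => v i + b i * v (Fin.last d) with hf
  have hfu := hvf.isUnimodular hvu
  have hl0 : Fin.last d ≠ 0 := by
    rw [Ne, Fin.ext_iff]; simp; omega
  have hlI : v (Fin.last d) ∈ Ideal.span {X ^ n} := by simpa [hl0] using hv1 (Fin.last d)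
  have hgf (i : Fin d) : algebraMap R S (g i.castSucc + a i * (x ^ n * g (Fin.last d))) =
      X ^ K * f i.castSucc := by
    simp only [map_add, map_mul, hg, map_pow, hf, b, Fin.snoc_castSucc, ← hX]
    ring
  have hgl : algebraMap R S (g (Fin.last d)) = X ^ K * f (Fin.last d) := by
    simp [hf, b, hg, hX]
  refine ⟨f, ⟨hfu, fun i => ?_⟩, hvf, K,
    fun i => g i.castSucc + a i * (x ^ n * g (Fin.last d)), hgf, ?_⟩
  · have : f i - (Pi.single 0 1 : Fin (d + 1) → S) i =
        (v i - (Pi.single 0 1 : Fin (d + 1) → S) i) + b i * v (Fin.last d) := by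
      simp only [hf]; ring
    rw [this]
    exact add_mem (hv1 i) (Ideal.mul_mem_left _ _ hlI)
  · apply exists_add_eq_one_of_le_height hdim
    intro P hP hle hxP
    refine ha P hP (fun i => hle (Ideal.subset_span ⟨i, rfl⟩)) fun hw => hxP ?_
    have hgP : g (Fin.last d) ∈ P :=
      (hP.mem_or_mem hw).resolve_left fun h => hxP (hP.mem_of_pow_mem n h)
    -- now `P` contains the numerators of all entries of `f`, which is unimodular over `S`, so that
    -- it contains a power of `x`
    obtain ⟨w, hw⟩ := hfu
    obtain ⟨k, w', hw'⟩ := exists_forall_map_eq_pow_mul h w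
    let g' : Fin (d + 1) → R := Fin.snoc (α := fun _ => R)
      (fun i : Fin d => g i.castSucc + a i * (x ^ n * g (Fin.last d))) (g (Fin.last d))
    have hg' (i) : algebraMap R S (g' i) = X ^ K * f i := by
      induction i using Fin.lastCases with
      | last => simp only [g', Fin.snoc_last, hgl]
      | cast i => simp only [g', Fin.snoc_castSucc, hgf]
    have hsum : ∑ i, g' i * w' i = x ^ (K + k) := by
      apply hRS
      simp only [map_sum, map_mul, hg', hw', map_pow, ← hX]
      rw [← mul_one (X ^ (K + k)), ← hw, Finset.mul_sum]
      exact Finset.sum_congr rfl fun i _ => by ring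
    refine hP.mem_of_pow_mem (K + k) (hsum ▸ P.sum_mem fun i _ => P.mul_mem_right _ ?_)
    induction i using Fin.lastCases with
    | last => simpa [g'] using hgP
    | cast i =>
      simp only [g', Fin.snoc_castSucc]
      exact hle (Ideal.subset_span ⟨i, rfl⟩)

end Away

/-! ### Clearing denominators -/

section ClearDenominators


variable {R S : Type*} [CommRing R] [CommRing S] [Algebra R S]

/-- As `x` is a unit modulo `τ`, the denominator of `s ∈ S ⊆ R[1/x]` can be removed by adding a
multiple of `τ`: a multiple `x ^ M * s` in `S` is congruent to a multiple `x ^ M * c` in `R` modulo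
`x ^ M * τ`. -/
theorem exists_sub_eq_mul_of_add_eq_one {x τ μ : R} (hτ : τ + x * μ = 1)
    (h : ∀ s : S, ∃ (k : ℕ) (r : R), algebraMap R S r = algebraMap R S x ^ k * s) (M : ℕ) (s : S) :
    ∃ (c : R) (e : S), algebraMap R S x ^ M * s - algebraMap R S (x ^ M * c) =
      e * algebraMap R S x ^ M * algebraMap R S τ := by
  obtain ⟨k, r, hr⟩ := h s
  -- `1 - (xμ)ᵏ` is a multiple of `τ = 1 - xμ`
  obtain ⟨a, ha⟩ : (1 - x * μ) ∣ 1 - (x * μ) ^ k := by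
    simpa using sub_dvd_pow_sub_pow 1 (x * μ) k
  have hτ' : τ * a = 1 - x ^ k * μ ^ k := by
    rw [← mul_pow, ha, ← hτ]; ring
  refine ⟨r * μ ^ k, s * algebraMap R S a, ?_⟩
  have := congrArg (algebraMap R S) hτ'
  simp only [map_mul, map_sub, map_one, map_pow] at this
  simp only [map_mul, map_pow, hr]
  linear_combination (-algebraMap R S x ^ M * s) * this

/-- The case of a positive exponent: every row in `Um_{d+1}(S, xⁿ)` can be moved into
`Um_{d+1}(R, xⁿ)` by `E_{d+1}(S, xⁿ)`. -/
theorem exists_um_rowEquiv [IsNoetherianRing R] {d n : ℕ} (hd : 2 ≤ d) (hn : 0 < n)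
    (hdim : ringKrullDim R ≤ d) (x : R)
    (hRS : Function.Injective (algebraMap R S))
    (h : ∀ s : S, ∃ (k : ℕ) (r : R), algebraMap R S r = algebraMap R S x ^ k * s)
    (v : Fin (d + 1) → S) (hv : v ∈ Um (d + 1) (Ideal.span {algebraMap R S x ^ n})) :
    ∃ u ∈ Um (d + 1) (Ideal.span {x ^ n}),
      RowEquiv (Ideal.span {algebraMap R S x ^ n}) v (fun i => algebraMap R S (u i)) := by
  obtain ⟨f, ⟨hfu, hf1⟩, hvf, K, g, hg, τ, μ, m, hτ, hmτ⟩ :=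
    exists_rowEquiv_saturation (by omega) hdim x hRS h v hv
  obtain ⟨b, hb⟩ := Ideal.mem_span_range_iff_exists_fun.1 hmτ
  obtain ⟨e, rfl⟩ : ∃ e, d = e + 2 := ⟨d - 2, by omega⟩
  set X := algebraMap R S x with hX
  set I := Ideal.span {X ^ n} with hI
  have hXI : X ^ n ∈ I := Ideal.mem_span_singleton_self _
  let l : Fin (e + 2 + 1) := Fin.last (e + 2)
  have h0l : (0 : Fin (e + 2 + 1)) ≠ l := by simp [l]
  have h1l : (1 : Fin (e + 2 + 1)) ≠ l := by simp [l, Fin.ext_iff]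
  have h01 : (0 : Fin (e + 2 + 1)) ≠ 1 := by simp
  have hf0 : f 0 - 1 ∈ I := by simpa using hf1 0
  have hfI (i) (hi : i ≠ 0) : f i ∈ I := by simpa [hi] using hf1 i
  -- a common power of `x` that clears all denominators, with a factor `xⁿ` to spare
  set k := K + n with hk
  have hXk : X ^ k ∈ I := by rw [hk, pow_add]; exact I.mul_mem_left _ hXI
  -- `f 0` is a unit modulo every power of `x`
  have hcop (N : ℕ) : ∃ y z, X ^ N * y + f 0 * z = 1 := by
    obtain ⟨c, hc⟩ := Ideal.mem_span_singleton'.1 hf0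
    have : IsCoprime (X ^ N) (f 0) := by
      apply IsCoprime.pow_left
      obtain ⟨m, rfl⟩ := Nat.exists_eq_succ_of_ne_zero hn.ne'
      exact ⟨-(c * X ^ m), 1, by rw [pow_succ] at hc; linear_combination -hc⟩
    obtain ⟨y, z, hyz⟩ := this
    exact ⟨y, z, by rw [← hyz]; ring⟩
  let s : Finset (Fin (e + 2 + 1)) := Finset.univ.filter fun i => i ≠ 0 ∧ i ≠ l
  have hs {i} : i ∈ s ↔ i ≠ 0 ∧ i ≠ l := by simp [s]
  set t := X ^ (2 * k) with ht
  -- make the last entry divisible by a high power of `x`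
  obtain ⟨c, hc, hfc⟩ : ∃ c ∈ I, RowEquiv I f (Function.update f l (t ^ s.card * c)) := by
    obtain ⟨y, z, hyz⟩ := hcop (2 * k * s.card)
    rw [pow_mul, ← ht] at hyz
    refine ⟨y * f l, I.mul_mem_left _ (hfI l h0l.symm), ?_⟩
    convert rowEquiv_update (a := -(z * f l)) h0l
      (I.neg_mem (I.mul_mem_left _ (hfI l h0l.symm))) f using 2
    linear_combination f l * hyz
  -- and distribute this power over the entries other than the first one
  set f₂ := Function.update f l (t ^ s.card * c) with hf₂
  have hf₂i (i) (hi : i ≠ l) : f₂ i = f i := by simp [f₂, hi]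
  obtain ⟨y₂, z₂, hyz₂⟩ := hcop (2 * k)
  have hf₂₃ := rowEquiv_move_factors (I := I) (t := t) (y := y₂) (z := z₂) (v := f₂) (c := c) h0l s
    (by simp [hs]) (by simp [hs]) (by rwa [hf₂i 0 h0l])
    (fun i hi => by rw [hf₂i i (hs.1 hi).2]; exact hfI i (hs.1 hi).1) hc (by simp [f₂])
    (by rwa [hf₂i 0 h0l])
  set f₃ : Fin (e + 2 + 1) → S :=
    fun i => if i = l then c else if i ∈ s then t * f₂ i else f₂ i with hf₃
  have hf₃l : f₃ l = c := by simp [f₃]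
  have hf₃0 : f₃ 0 = f 0 := by simp [f₃, h0l, hs, hf₂i]
  have hf₃i (i) (hi : i ≠ 0) (hil : i ≠ l) : f₃ i = t * f i := by
    simp [f₃, hil, hs, hf₂i, hi]
  -- `q` is the entry that will finally be replaced by an element of `R`
  set M := m + 2 * k + n with hM
  obtain ⟨y₃, z₃, hyz₃⟩ := hcop M
  set q := 1 - X ^ M * (y₃ * (1 - c)) with hq
  have hXM : X ^ M ∈ I := by rw [hM, pow_add]; exact I.mul_mem_left _ hXI
  have hqI : q - 1 ∈ I := by
    have : q - 1 = -(y₃ * (1 - c)) * X ^ M := by rw [hq]; ring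
    rw [this]
    exact I.mul_mem_left _ hXM
  have hf₃₄ : RowEquiv I f₃ (Function.update f₃ l (q - f 0)) := by
    convert rowEquiv_update (a := z₃ * (1 - c) - 1) h0l ?_ f₃ using 2
    · rw [hf₃l, hf₃0, hq]
      linear_combination (c - 1) * hyz₃
    · have : z₃ * (1 - c) - 1 = -(z₃ * (f 0 - 1)) - y₃ * X ^ M - z₃ * c := by
        linear_combination hyz₃
      rw [this]
      exact I.sub_mem (I.sub_mem (I.neg_mem (I.mul_mem_left _ hf0)) (I.mul_mem_left _ hXM))
        (I.mul_mem_left _ hc)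
  set f₄ := Function.update f₃ l (q - f 0) with hf₄
  -- conjugate by `γ`, so that `q` becomes the entry congruent to `1`
  let γ := SpecialLinearGroup.transvection h0l (1 : S) *
    SpecialLinearGroup.transvection h0l.symm (-1 : S)
  have hγ : γ ∈ E (e + 2 + 1) S := mul_mem (transvection_mem_E _ _) (transvection_mem_E _ _)
  have hγv (w : Fin (e + 2 + 1) → S) : w ᵥ* γ.1 =
      Function.update (Function.update w l (w l + w 0)) 0 (- w l) := by
    rw [vecMul_coe_mul, vecMul_transvection, vecMul_transvection]
    congr 1
    · rw [one_mul]
    · simp [h0l]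
  set p₁ : Fin (e + 2 + 1) → S := f₄ ᵥ* γ.1 with hp₁
  have hp₁0 : p₁ 0 = f 0 - q := by simp [hp₁, hγv, f₄]
  have hp₁l : p₁ l = q := by simp [hp₁, hγv, h0l.symm, f₄, h0l, hf₃0]
  have hp₁i (i) (hi : i ≠ 0) (hil : i ≠ l) : p₁ i = t * f i := by
    simp [hp₁, hγv, hi, hil, f₄, hf₃i]
  -- share the factors `x` of the entry `1` with the entry `0`
  have hp₁₂ := rowEquiv_move_factor (I := I) (v := p₁) (p := l) (i := 0) (j := 1) (t := X ^ k)
    (c := X ^ k * f 1) (y := X ^ (m + k + n) * (y₃ * (1 - c))) (z := 1) h0l.symm h1l.symm h01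
    (by rwa [hp₁l]) (by
      rw [hp₁0]
      have : f 0 - q = (f 0 - 1) - (q - 1) := by ring
      rw [this]
      exact I.sub_mem hf0 hqI)
    (I.mul_mem_right _ hXk) (by rw [hp₁i 1 h01.symm h1l, ht]; ring) (by
      rw [hp₁l, hq, hM]
      ring)
  set p₂ := Function.update (Function.update p₁ 0 (X ^ k * p₁ 0)) 1 (X ^ k * f 1) with hp₂
  have hp₂l : p₂ l = q := by simp [p₂, h0l.symm, h1l.symm, hp₁l]
  have hp₂₃ := rowEquiv_update h0l.symm hXk p₂
  have hp₂0 : p₂ 0 + X ^ k * p₂ l = X ^ k * f 0 := by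
    rw [hp₂l]
    simp only [p₂, Function.update_of_ne h01, Function.update_self, hp₁0]
    ring
  rw [hp₂0] at hp₂₃
  set p₃ := Function.update p₂ 0 (X ^ k * f 0) with hp₃
  have hp₃0 : p₃ 0 = X ^ k * f 0 := by simp [p₃]
  have hp₃l : p₃ l = q := by simp [p₃, h0l.symm, hp₂l]
  have hp₃1 : p₃ 1 = X ^ k * f 1 := by simp [p₃, h01.symm, p₂]
  have hp₃i (i) (hi : i ≠ 0) (hi1 : i ≠ 1) (hil : i ≠ l) : p₃ i = t * f i := by
    simp [p₃, p₂, hi, hi1, hp₁i i hi hil]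
  -- replace `q` by an element `1 + x ^ M * r` of `R`
  obtain ⟨r, a, hra⟩ := exists_sub_eq_mul_of_add_eq_one hτ h M (-(y₃ * (1 - c)))
  have hdiv (i : Fin (e + 2)) : ∃ j, t * algebraMap R S (g i) = j * p₃ i.castSucc := by
    rw [hg]
    have hil : i.castSucc ≠ l := (Fin.castSucc_lt_last i).ne
    by_cases hi : i.castSucc = 0
    · exact ⟨X ^ (k + K), by rw [hi, hp₃0, ht]; ring⟩
    · by_cases hi1 : i.castSucc = 1
      · exact ⟨X ^ (k + K), by rw [hi1, hp₃1, ht]; ring⟩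
      · exact ⟨X ^ K, by rw [hp₃i _ hi hi1 hil]; ring⟩
  choose j hj using hdiv
  let o : Fin (e + 2 + 1) → S := Fin.snoc (α := fun _ => S)
    (fun i => -(a * algebraMap R S (b i) * j i) * X ^ n) 0
  have hp₃₄ : RowEquiv I p₃ (Function.update p₃ l (1 + X ^ M * algebraMap R S r)) := by
    convert rowEquiv_update_sum (I := I) l (Finset.univ.erase l) (by simp) o (fun i hi => ?_) p₃
      using 2
    · have h1 : ∑ i ∈ Finset.univ.erase l, o i * p₃ i = ∑ i, o i * p₃ i := by
        rw [← Finset.sum_erase_add _ _ (Finset.mem_univ l)]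
        simp [o, l]
      have h2 : ∑ i, o i * p₃ i = -(a * X ^ M * algebraMap R S τ) := by
        have h3 : X ^ m * algebraMap R S τ = ∑ i, algebraMap R S (b i) * algebraMap R S (g i) := by
          rw [hX, ← map_pow, ← map_mul, ← hb]
          simp
        have h4 : a * X ^ M * algebraMap R S τ = a * X ^ n * t * (X ^ m * algebraMap R S τ) := by
          rw [hM, ht]; ring
        rw [Fin.sum_univ_castSucc, h4, h3, Finset.mul_sum, ← Finset.sum_neg_distrib]
        simp only [o, Fin.snoc_castSucc, Fin.snoc_last, zero_mul, add_zero]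
        refine Finset.sum_congr rfl fun i _ => ?_
        linear_combination (a * X ^ n * algebraMap R S (b i)) * hj i
      rw [h1, h2, hp₃l, hq]
      rw [map_mul, map_pow, ← hX] at hra
      linear_combination -hra
    · induction i using Fin.lastCases with
      | last => simp [l] at hi
      | cast i =>
        simp only [o, Fin.snoc_castSucc]
        exact I.mul_mem_left _ hXI
  -- conjugate back
  have hchain := ((hp₁₂.trans hp₂₃).trans hp₃₄).vecMul (inv_mem hγ)
  rw [hp₁, vecMul_coe_mul_inv] at hchain
  have hall := (((hvf.trans hfc).trans hf₂₃).trans hf₃₄).trans hchain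
  let u : Fin (e + 2 + 1) → R := Fin.snoc (α := fun _ => R)
    (fun i => if i.castSucc = 0 then x ^ n * g i + (1 + x ^ M * r)
      else if i.castSucc = 1 then x ^ n * g i else x ^ (k + n) * g i) (-(x ^ n * g 0))
  have hfg (i : Fin (e + 2)) : X ^ n * algebraMap R S (g i) = X ^ k * f i.castSucc := by
    rw [hg, hk]; ring
  have hul : algebraMap R S (u l) = -(X ^ k * f 0) := by
    simp only [u, l, Fin.snoc_last, map_neg, map_mul, map_pow, ← hX, hfg, Fin.castSucc_zero]
  have hu0 : algebraMap R S (u 0) = X ^ k * f 0 + (1 + X ^ M * algebraMap R S r) := by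
    have : u 0 = x ^ n * g 0 + (1 + x ^ M * r) :=
      (Fin.snoc_castSucc (α := fun _ => R) _ _ 0).trans (if_pos Fin.castSucc_zero)
    simp only [this, map_add, map_mul, map_pow, map_one, ← hX, hfg, Fin.castSucc_zero]
  have hu : (Function.update p₃ l (1 + X ^ M * algebraMap R S r)) ᵥ* (γ⁻¹).1 =
      fun i => algebraMap R S (u i) := by
    have : (Function.update p₃ l (1 + X ^ M * algebraMap R S r)) =
        (fun i => algebraMap R S (u i)) ᵥ* γ.1 := by
      rw [hγv, hul, hu0]
      ext i
      by_cases hi : i = 0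
      · subst hi
        simp [h0l, hp₃0]
      · by_cases hil : i = l
        · subst hil
          simp [hi]
        · obtain ⟨i, rfl⟩ := Fin.exists_castSucc_eq.2 hil
          by_cases hi1 : i.castSucc = 1
          · simp only [Function.update_of_ne hi, Function.update_of_ne hil]
            simp only [u, Fin.snoc_castSucc, if_neg hi, if_pos hi1, map_mul, map_pow, ← hX, hfg]
            rw [hi1, hp₃1]
          · simp only [Function.update_of_ne hi, Function.update_of_ne hil]
            simp only [u, Fin.snoc_castSucc, if_neg hi, if_neg hi1, map_mul, map_pow, ← hX]
            rw [hp₃i _ hi hi1 hil, pow_add, mul_assoc, hfg, ht]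
            ring
    rw [this, vecMul_coe_mul_inv]
  rw [hu] at hall
  have hxI : x ^ n ∈ Ideal.span {x ^ n} := Ideal.mem_span_singleton_self _
  have huI (i) : u i - (Pi.single 0 1 : Fin (e + 2 + 1) → R) i ∈ Ideal.span {x ^ n} := by
    induction i using Fin.lastCases with
    | last =>
      have : (Pi.single 0 1 : Fin (e + 2 + 1) → R) (Fin.last (e + 2)) = 0 := by
        simp [Fin.ext_iff]
      simp only [u, Fin.snoc_last, this, sub_zero]
      exact neg_mem (Ideal.mul_mem_right _ _ hxI)
    | cast i =>
      simp only [u, Fin.snoc_castSucc]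
      by_cases hi : i.castSucc = 0
      · have : x ^ n * g i + (1 + x ^ M * r) - 1 =
            x ^ n * g i + x ^ (m + 2 * k) * r * x ^ n := by
          rw [hM]; ring
        rw [if_pos hi, hi, Pi.single_eq_same, this]
        exact add_mem (Ideal.mul_mem_right _ _ hxI) (Ideal.mul_mem_left _ _ hxI)
      · rw [if_neg hi, Pi.single_eq_of_ne hi, sub_zero]
        split_ifs
        · exact Ideal.mul_mem_right _ _ hxI
        · rw [pow_add, mul_assoc]
          exact Ideal.mul_mem_left _ _ (Ideal.mul_mem_right _ _ hxI)
  refine ⟨u, ⟨isUnimodular_of_map hn hRS h u ?_ (hall.isUnimodular hv.1), huI⟩, hall⟩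
  simpa using huI 0

end ClearDenominators

end UnimodularRows

theorem lemma3p3 {R S : Type*} [CommRing R] [CommRing S] [IsNoetherianRing R] [IsNoetherianRing S]
    [Algebra R S] (hRS : Function.Injective (algebraMap R S))
    (d : ℕ) (hd : 2 ≤ d) (hdimR : ringKrullDim R ≤ d) (hdimS : ringKrullDim S ≤ d)
    (x : R) (hx : algebraMap R S x ∈ nonZeroDivisors S)
    (hloc : Function.Bijective (Localization.awayMap (algebraMap R S) x)) (n : ℕ) :
    Function.Surjective
      (UnimodularRows.UmModE.map (d + 1) (algebraMap R S)
        (UnimodularRows.span_pow_le_comap (algebraMap R S) x n)) := by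
  have h := UnimodularRows.exists_map_eq_pow_mul hx hloc.surjective
  suffices H : ∀ v ∈ UnimodularRows.Um (d + 1) (Ideal.span {algebraMap R S x ^ n}),
      ∃ u ∈ UnimodularRows.Um (d + 1) (Ideal.span {x ^ n}),
        UnimodularRows.RowEquiv (Ideal.span {algebraMap R S x ^ n}) v
          (fun i => algebraMap R S (u i)) by
    rintro ⟨v⟩
    obtain ⟨u, hu, hvu⟩ := H v.1 v.2
    exact ⟨Quotient.mk _ ⟨u, hu⟩, Quotient.sound hvu.symm⟩
  intro v hv
  rcases Nat.eq_zero_or_pos n with rfl | hn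
  · obtain ⟨w, hw, hvw⟩ := UnimodularRows.exists_rowEquiv_mem_um (by omega) hdimS hx v hv.1
    rw [← pow_one (algebraMap R S x)] at hw
    obtain ⟨u, hu, hwu⟩ := UnimodularRows.exists_um_rowEquiv hd one_pos hdimR x hRS h w hw
    refine ⟨u, ⟨hu.1, fun i => by simp⟩, ?_⟩
    have htop : Ideal.span {algebraMap R S x ^ 0} = ⊤ := by simp
    rw [htop]
    exact hvw.trans (hwu.mono le_top)
  · exact UnimodularRows.exists_um_rowEquiv hd hn hdimR x hRS h v hv
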